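/- Let $E$ be a Polish space, let $\mathcal P(E)$ be the set of Borel probability measures on $E$ with the topology of weak convergence, let $\mu\in\mathcal P(E)$, and let $c:E\times E\to[0,\infty]$ be lower semicontinuous. For $\nu\in\mathcal P(E)$ let $\Pi(\mu,\nu)$ be the set of Borel probability measures on $E\times E$ with first marginal $\mu$ and second marginal $\nu$, let $\Pi(\mu)=\bigcup_{\nu\in\mathcal P(E)}\Pi(\mu,\nu)$, and put $$\alpha(\nu)=\inf_{\pi\in\Pi(\mu,\nu)}\int_{E\times E}c\,d\pi\in[0,\infty].$$ Suppose that for every compact set $K\subset E$ and every real $m\ge 0$ the set $\{y\in E:\inf_{x\in K}c(x,y)\le m\}$ has compact closure (where $\inf\emptyset=\infty$). Let $(X_i)_{i\ge1}$ be i.i.d. $E$-valued random variables with law $\mu$ on a probability space. For $n\ge1$ let $\mathcal Y_n$ be the set of $n$-tuples $(Y_1,\dots,Y_n)$ of $E$-valued random variables such that $Y_k$ is measurable with respect to $\sigma(X_1,\dots,X_k)$ for each $k=1,\dots,n$, and let $L_n(y_1,\dots,y_n)=\frac1n\sum_{i=1}^n\delta_{y_i}\in\mathcal P(E)$. Then for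 every bounded continuous $F:\mathcal P(E)\to\mathbb R$, $$\lim_{n\to\infty}\ \sup_{(Y_1,\dots,Y_n)\in\mathcal Y_n}\mathbb E\Big[F(L_n(Y_1,\dots,Y_n))-\frac1n\sum_{i=1}^nc(X_i,Y_i)\Big]=\sup_{\nu\in\mathcal P(E)}\big(F(\nu)-\alpha(\nu)\big)=\sup_{\pi\in\Pi(\mu)}\Big(F(\pi(E\times\cdot))-\int_{E\times E}c\,d\pi\Big),$$ where all quantities, and the limit, are taken in $[-\infty,\infty)$. -/

import Mathlib

open MeasureTheory ProbabilityTheory Filter Topology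
open scoped ENNReal NNReal BoundedContinuousFunction

noncomputable section

namespace TransportControl

section Transport

variable {E : Type*} [MeasurableSpace E]

/-- `Π(μ, ν)`: the probability measures on `E × E` with first marginal `μ` and second
marginal `ν`. -/
def couplings (μ ν : ProbabilityMeasure E) : Set (ProbabilityMeasure (E × E)) :=
  {π | π.map measurable_fst.aemeasurable = μ ∧ π.map measurable_snd.aemeasurable = ν}

/-- `Π(μ) = ⋃ ν, Π(μ, ν)`. -/
def couplingsFrom (μ : ProbabilityMeasure E) : Set (ProbabilityMeasure (E × E)) :=
  ⋃ ν : ProbabilityMeasure E, couplings μ ν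

/-- The optimal transport cost `α(ν) = inf {∫ c dπ : π ∈ Π(μ, ν)} ∈ [0, ∞]`. -/
def transportCost (c : E × E → ℝ≥0∞) (μ ν : ProbabilityMeasure E) : ℝ≥0∞ :=
  ⨅ π ∈ couplings μ ν, ∫⁻ z, c z ∂(π : Measure (E × E))

/-- The empirical measure `L_n(x₁, …, x_n) = (1/n) ∑ δ_{x_i}`, for `n ≥ 1`. -/
def empiricalMeasure {n : ℕ} [NeZero n] (x : Fin n → E) : ProbabilityMeasure E :=
  ⟨(n : ℝ≥0∞)⁻¹ • ∑ i, Measure.dirac (x i), ⟨by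
    simp [ENNReal.inv_mul_cancel (Nat.cast_ne_zero.mpr (NeZero.ne n))
      (ENNReal.natCast_ne_top n)]⟩⟩

end Transport

section Control

variable {E Ω : Type*} [MeasurableSpace E]

/-- The set `𝒴_n` of adapted controls `(Y₁, …, Y_n)`: `Y_k` is measurable with respect to the
`σ`-algebra generated by `X₁, …, X_k`. Indices are shifted to start at `0`. -/
def adaptedControls (X : ℕ → Ω → E) (n : ℕ) : Set (Fin n → Ω → E) :=
  {Y | ∀ k : Fin n,
    Measurable[⨆ (j : ℕ) (_ : j ≤ (k : ℕ)), MeasurableSpace.comap (X j) inferInstance] (Y k)}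

variable [TopologicalSpace E] [OpensMeasurableSpace E] [MeasurableSpace Ω]

/-- The objective `𝔼[F(L_n(Y₁, …, Y_n)) - (1/n) ∑ c(X_i, Y_i)] ∈ [-∞, ∞)`. Since `F` is bounded
and `c ≥ 0`, it is the (finite) expectation of the first term minus the (possibly infinite)
expectation of the second. -/
def objective (P : Measure Ω) (X : ℕ → Ω → E) (c : E × E → ℝ≥0∞)
    (F : ProbabilityMeasure E →ᵇ ℝ) {n : ℕ} [NeZero n] (Y : Fin n → Ω → E) : EReal :=
  ((∫ ω, F (empiricalMeasure fun i => Y i ω) ∂P : ℝ) : EReal)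
    - ((∫⁻ ω, (n : ℝ≥0∞)⁻¹ * ∑ i : Fin n, c (X i ω, Y i ω) ∂P : ℝ≥0∞) : EReal)

/-- The value of the `n`-step adapted control problem, for `n ≥ 1`. -/
def controlValue (P : Measure Ω) (X : ℕ → Ω → E) (c : E × E → ℝ≥0∞)
    (F : ProbabilityMeasure E →ᵇ ℝ) (n : ℕ) [NeZero n] : EReal :=
  ⨆ Y ∈ adaptedControls X n, objective P X c F Y

end Control

end TransportControl

end

/-! Subtracting every payoff from `‖F‖` turns the problem into minimising a gap in `[0, ∞]`, namely
`‖F‖ - F` plus transport cost. The map `subENNReal ‖F‖` is continuous and order-reversing, so it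
carries infima and limits back to the payoffs. It remains to show that the minimal expected gaps
tend to `staticGap`.

Lower bound: almost surely the empirical measures of `X` converge to `μ`. Along a subsequence with
bounded gaps, the empirical measures of the pairs `(X_i, Y_i)` are tight by the compactness
assumption on `c`. A limit point has first marginal `μ`, and lower semicontinuity of the cost bounds
the gap below (`staticGap_le_liminf_pathwiseGap`). Fatou then handles the expectation.

Upper bound: a coupling `π` is the law of `(X, h(X, U))`, with `U` uniform and independent of `X`.
For i.i.d. pairs of law `π` the expected gap tends to that of `π`, by the law of large numbers.
Fixing the `U_i` at values no worse than average leaves an adapted control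
(`exists_mem_adaptedControls_expectedGap_le`). -/

namespace TransportControl

/-! ### Empirical measures -/

section EmpiricalMeasure

variable {E E' : Type*} [MeasurableSpace E] [MeasurableSpace E'] {n : ℕ} [NeZero n]

lemma lintegral_empiricalMeasure (x : Fin n → E) {f : E → ℝ≥0∞} (hf : Measurable f) :
    ∫⁻ z, f z ∂(empiricalMeasure x : Measure E) = (n : ℝ≥0∞)⁻¹ * ∑ i, f (x i) := by
  change ∫⁻ z, f z ∂((n : ℝ≥0∞)⁻¹ • ∑ i, Measure.dirac (x i)) = _
  rw [lintegral_smul_measure, lintegral_finsetSum_measure, smul_eq_mul]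
  simp_rw [lintegral_dirac' _ hf]

lemma map_empiricalMeasure (x : Fin n → E) {f : E → E'} (hf : Measurable f) :
    (empiricalMeasure x).map hf.aemeasurable = empiricalMeasure fun i => f (x i) := by
  apply Subtype.ext
  refine Measure.ext_of_lintegral _ fun g hg => ?_
  change ∫⁻ a, g a ∂((empiricalMeasure x).map hf.aemeasurable : Measure E')
    = ∫⁻ a, g a ∂(empiricalMeasure (fun i => f (x i)) : Measure E')
  rw [ProbabilityMeasure.toMeasure_map, lintegral_map hg hf, lintegral_empiricalMeasure _ hg,
    lintegral_empiricalMeasure x (f := fun a => g (f a)) (hg.comp hf)]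

lemma empiricalMeasure_real_apply (x : Fin n → E) {s : Set E} (hs : MeasurableSet s) :
    (empiricalMeasure x : Measure E).real s = (∑ i, s.indicator 1 (x i)) / n := by
  have h : (empiricalMeasure x : Measure E) s
      = (n : ℝ≥0∞)⁻¹ * ∑ i, s.indicator 1 (x i) := by
    rw [← lintegral_indicator_one hs, lintegral_empiricalMeasure _ (measurable_one.indicator hs)]
  rw [measureReal_def, h, ENNReal.toReal_mul, ENNReal.toReal_sum, div_eq_inv_mul]
  · congr 1
    · simp
    · refine Finset.sum_congr rfl fun i _ => ?_
      by_cases hi : x i ∈ s <;> simp [hi]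
  · intro i _
    by_cases hi : x i ∈ s <;> simp [hi]

lemma continuous_empiricalMeasure [TopologicalSpace E] [OpensMeasurableSpace E] :
    Continuous fun x : Fin n → E => empiricalMeasure x := by
  refine continuous_iff_continuousAt.2 fun x => ?_
  refine ProbabilityMeasure.tendsto_iff_forall_lintegral_tendsto.2 fun f => ?_
  have hf : Measurable fun z => (f z : ℝ≥0∞) := f.continuous.measurable.coe_nnreal_ennreal
  simp_rw [lintegral_empiricalMeasure _ hf]
  have : Continuous fun y : Fin n → E => (n : ℝ≥0)⁻¹ * ∑ i, f (y i) := by fun_prop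
  have h2 := (ENNReal.continuous_coe.comp this).tendsto x
  simpa [Function.comp_def, ENNReal.coe_inv (Nat.cast_ne_zero.2 (NeZero.ne n))] using h2

end EmpiricalMeasure

/-! ### Lower semicontinuity of the cost under weak convergence -/

section LowerSemicontinuity

/-- Layer cake formula, with the value `∞` allowed: Tonelli on the region under the graph. -/
lemma lintegral_eq_lintegral_measure_ofReal_lt {Z : Type*} [MeasurableSpace Z] (ρ : Measure Z)
    [SFinite ρ] {f : Z → ℝ≥0∞} (hf : Measurable f) :
    ∫⁻ z, f z ∂ρ = ∫⁻ t in Set.Ioi (0 : ℝ), ρ {z | ENNReal.ofReal t < f z} := by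
  have hset : MeasurableSet {p : Z × ℝ | ENNReal.ofReal p.2 < f p.1} :=
    measurableSet_lt (by fun_prop) (by fun_prop)
  have h1 : ∀ z, f z = ∫⁻ t in Set.Ioi (0 : ℝ),
      {p : Z × ℝ | ENNReal.ofReal p.2 < f p.1}.indicator 1 (z, t) := by
    intro z
    have h2 : (fun t : ℝ => {p : Z × ℝ | ENNReal.ofReal p.2 < f p.1}.indicator
        (1 : Z × ℝ → ℝ≥0∞) (z, t)) = {t : ℝ | ENNReal.ofReal t < f z}.indicator 1 := by
      ext t; simp [Set.indicator_apply]
    rw [h2, lintegral_indicator_one (measurableSet_lt (by fun_prop) (by fun_prop)),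
      Measure.restrict_apply (measurableSet_lt (by fun_prop) (by fun_prop))]
    by_cases hz : f z = ∞
    · simp [hz]
    · have h3 : {t : ℝ | ENNReal.ofReal t < f z} ∩ Set.Ioi 0 = Set.Ioo 0 (f z).toReal := by
        ext t
        simp only [Set.mem_inter_iff, Set.mem_ofPred_eq, Set.mem_Ioi, Set.mem_Ioo]
        constructor
        · rintro ⟨h, h0⟩
          exact ⟨h0, (ENNReal.ofReal_lt_iff_lt_toReal h0.le hz).1 h⟩
        · rintro ⟨h0, h⟩
          exact ⟨(ENNReal.ofReal_lt_iff_lt_toReal h0.le hz).2 h, h0⟩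
      rw [h3, Real.volume_Ioo, sub_zero, ENNReal.ofReal_toReal hz]
  have h4 : ∀ t : ℝ, ρ {z | ENNReal.ofReal t < f z}
      = ∫⁻ z, {p : Z × ℝ | ENNReal.ofReal p.2 < f p.1}.indicator 1 (z, t) ∂ρ := by
    intro t
    rw [← lintegral_indicator_one (measurableSet_lt (by fun_prop) (by fun_prop))]
    congr 1
  calc ∫⁻ z, f z ∂ρ = ∫⁻ z, (∫⁻ t in Set.Ioi (0 : ℝ),
      {p : Z × ℝ | ENNReal.ofReal p.2 < f p.1}.indicator 1 (z, t)) ∂ρ := lintegral_congr h1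
    _ = ∫⁻ t in Set.Ioi (0 : ℝ), ∫⁻ z,
      {p : Z × ℝ | ENNReal.ofReal p.2 < f p.1}.indicator 1 (z, t) ∂ρ :=
        lintegral_lintegral_swap (f := fun z t =>
          {p : Z × ℝ | ENNReal.ofReal p.2 < f p.1}.indicator 1 (z, t)) (measurable_one.indicator hset).aemeasurable
    _ = _ := by simp_rw [h4]

/-- A lower semicontinuous function has a sequentially lower semicontinuous integral with respect
to weak convergence. -/
lemma lintegral_le_liminf_lintegral_of_tendsto {Z : Type*} [TopologicalSpace Z]
    [MeasurableSpace Z] [OpensMeasurableSpace Z] [HasOuterApproxClosed Z] {f : Z → ℝ≥0∞}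
    (hf : LowerSemicontinuous f) {πs : ℕ → ProbabilityMeasure Z} {π : ProbabilityMeasure Z}
    (h : Tendsto πs atTop (𝓝 π)) :
    ∫⁻ z, f z ∂(π : Measure Z) ≤ liminf (fun n => ∫⁻ z, f z ∂(πs n : Measure Z)) atTop := by
  simp_rw [lintegral_eq_lintegral_measure_ofReal_lt _ hf.measurable]
  -- Superlevel sets are open, so the portmanteau theorem applies at each level `t`; Fatou
  -- integrates over `t`.
  refine (lintegral_mono fun t => ProbabilityMeasure.le_liminf_measure_open_of_tendsto h
    (hf.isOpen_preimage (ENNReal.ofReal t))).trans (lintegral_liminf_le fun n => ?_)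
  exact Antitone.measurable fun s t hst => measure_mono fun z hz =>
    (ENNReal.ofReal_le_ofReal hst).trans_lt hz

end LowerSemicontinuity

/-! ### Law of large numbers for empirical measures -/

section LawOfLargeNumbers

variable {E Ω : Type*} [TopologicalSpace E] [SecondCountableTopology E] [MeasurableSpace E]
  [OpensMeasurableSpace E] [MeasurableSpace Ω]

/-- Almost sure weak convergence of the empirical measures of an i.i.d. sequence. -/
lemma ae_tendsto_empiricalMeasure (P : Measure Ω) [IsProbabilityMeasure P]
    (ν : ProbabilityMeasure E) (X : ℕ → Ω → E) (hX : ∀ i, Measurable (X i))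
    (hlaw : ∀ i, P.map (X i) = (ν : Measure E)) (hindep : iIndepFun X P) :
    ∀ᵐ ω ∂P, Tendsto (fun n : ℕ => empiricalMeasure fun i : Fin (n + 1) => X i ω) atTop
      (𝓝 ν) := by
  let B := TopologicalSpace.countableBasis E
  -- Finite intersections of basic open sets form a countable π-system: countability gives one
  -- common null set, and convergence on the π-system implies weak convergence.
  let S : Set (Set E) := (fun t : Set (Set E) => ⋂₀ t) '' {t | t.Finite ∧ t ⊆ B}
  have hScount : S.Countable :=
    (Set.countable_ofPred_finite_subset (TopologicalSpace.countable_countableBasis E)).image _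
  have hSopen : ∀ s ∈ S, IsOpen s := by
    rintro _ ⟨t, ⟨ht, htB⟩, rfl⟩
    exact ht.isOpen_sInter fun u hu => TopologicalSpace.isOpen_of_mem_countableBasis (htB hu)
  have hSpi : IsPiSystem S := by
    rintro _ ⟨t, ⟨ht, htB⟩, rfl⟩ _ ⟨t', ⟨ht', htB'⟩, rfl⟩ _
    exact ⟨t ∪ t', ⟨ht.union ht', Set.union_subset htB htB'⟩, Set.sInter_union t t'⟩
  have hSmeas : ∀ s ∈ S, MeasurableSet s := fun s hs => (hSopen s hs).measurableSet
  have hconv : ∀ s ∈ S, ∀ᵐ ω ∂P,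
      Tendsto (fun n : ℕ => (empiricalMeasure (fun i : Fin (n + 1) => X i ω) : Measure E).real s)
        atTop (𝓝 ((ν : Measure E).real s)) := by
    intro s hs
    have hm : Measurable (s.indicator (1 : E → ℝ)) := measurable_one.indicator (hSmeas s hs)
    have hid : ∀ i, IdentDistrib (X i) (X 0) P P := fun i =>
      ⟨(hX i).aemeasurable, (hX 0).aemeasurable, by rw [hlaw, hlaw]⟩
    have h := strong_law_ae_real (μ := P) (fun i ω => s.indicator (1 : E → ℝ) (X i ω))
      ((integrable_indicator_iff ((hSmeas s hs).preimage (hX 0))).2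
        (integrable_const (1 : ℝ)).integrableOn)
      (fun i j hij => (hindep.indepFun hij).comp hm hm) (fun i => (hid i).comp hm)
    have hE : ∫ ω, s.indicator (1 : E → ℝ) (X 0 ω) ∂P = (ν : Measure E).real s := by
      rw [← hlaw 0, ← integral_indicator_one (hSmeas s hs),
        integral_map (hX 0).aemeasurable hm.aestronglyMeasurable]
    filter_upwards [h] with ω hω
    rw [hE] at hω
    refine (hω.comp (tendsto_add_atTop_nat 1)).congr fun n => ?_
    rw [empiricalMeasure_real_apply _ (hSmeas s hs), Function.comp_apply,
      Finset.sum_range (fun i => s.indicator (1 : E → ℝ) (X i ω))]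
  filter_upwards [(ae_ball_iff hScount).2 hconv] with ω hω
  refine hSpi.tendsto_probabilityMeasure_of_tendsto_of_mem hSmeas (fun u hu x hxu => ?_)
    fun s hs => ?_
  · obtain ⟨v, hv, hxv, hvu⟩ :=
      (TopologicalSpace.isBasis_countableBasis E).exists_subset_of_mem_open hxu hu
    exact ⟨v, ⟨{v}, ⟨Set.finite_singleton v, Set.singleton_subset_iff.2 hv⟩,
      Set.sInter_singleton v⟩,
      (TopologicalSpace.isOpen_of_mem_countableBasis hv).mem_nhds hxv, hvu⟩
  · exact tendsto_subtype_rng.2 (by simpa using hω s hs)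

end LawOfLargeNumbers

/-! ### Asymptotic lower bound on the gap by compactness -/

section UpperBound

variable {E : Type*} [TopologicalSpace E] [MeasurableSpace E]

/-- The nonnegative gap `‖F‖ - F(ν)`. -/
noncomputable def penalty [OpensMeasurableSpace E] (F : ProbabilityMeasure E →ᵇ ℝ) (ν : ProbabilityMeasure E) :
    ℝ≥0∞ :=
  ENNReal.ofReal (‖F‖ - F ν)

/-- The gap `‖F‖ - F(L_n(y)) + (1/n) ∑ c(x_i, y_i)`. -/
noncomputable def pathwiseGap [OpensMeasurableSpace E] (c : E × E → ℝ≥0∞) (F : ProbabilityMeasure E →ᵇ ℝ)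
    {n : ℕ} [NeZero n] (x y : Fin n → E) : ℝ≥0∞ :=
  penalty F (empiricalMeasure y) + (n : ℝ≥0∞)⁻¹ * ∑ i, c (x i, y i)

/-- The smallest gap `‖F‖ - F(π₂) + ∫ c dπ` over the couplings `π` with first marginal `μ`. -/
noncomputable def staticGap [OpensMeasurableSpace E] (c : E × E → ℝ≥0∞) (F : ProbabilityMeasure E →ᵇ ℝ)
    (μ : ProbabilityMeasure E) : ℝ≥0∞ :=
  ⨅ (π : ProbabilityMeasure (E × E)) (_ : π.map measurable_fst.aemeasurable = μ),
    penalty F (π.map measurable_snd.aemeasurable) + ∫⁻ z, c z ∂(π : Measure (E × E))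

lemma continuous_penalty [OpensMeasurableSpace E] (F : ProbabilityMeasure E →ᵇ ℝ) :
    Continuous (penalty F) :=
  ENNReal.continuous_ofReal.comp (continuous_const.sub F.continuous)

lemma penalty_le [OpensMeasurableSpace E] (F : ProbabilityMeasure E →ᵇ ℝ)
    (ν : ProbabilityMeasure E) : penalty F ν ≤ ENNReal.ofReal (‖F‖ + ‖F‖) := by
  refine ENNReal.ofReal_le_ofReal ?_
  have := (abs_le.1 (F.norm_coe_le_norm ν)).1
  linarith

variable [PolishSpace E] [BorelSpace E]

/-- If the first coordinate lies in a compact `K` and the cost is below `m`, the second lies in a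
fixed compact set. Tightness of the first marginals and Markov's inequality control the two
exceptional events. -/
lemma isTightMeasureSet_of_lintegral_le {c : E × E → ℝ≥0∞} (hc : Measurable c)
    (hK : ∀ K : Set E, IsCompact K → ∀ m : ℝ≥0,
      IsCompact (closure {y : E | (⨅ x ∈ K, c (x, y)) ≤ (m : ℝ≥0∞)}))
    {S : Set (Measure (E × E))} (hS : IsTightMeasureSet (Measure.fst '' S)) {b : ℝ≥0∞}
    (hb : b ≠ ∞) (hSb : ∀ π ∈ S, ∫⁻ z, c z ∂π ≤ b) : IsTightMeasureSet S := by
  refine IsTightMeasureSet.prodMk hS ?_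
  rw [isTightMeasureSet_iff_exists_isCompact_measure_compl_le] at hS ⊢
  intro ε hε
  have hε2 : 0 < ε / 2 := ENNReal.half_pos hε.ne'
  obtain ⟨K, hKc, hKS⟩ := hS (ε / 2) hε2
  obtain ⟨m, hm0, hm⟩ : ∃ m : ℝ≥0, 0 < m ∧ b / m ≤ ε / 2 := by
    obtain ⟨m, hm⟩ := ENNReal.exists_nat_mul_gt hε2.ne' hb
    refine ⟨m + 1, by positivity, ENNReal.div_le_of_le_mul ?_⟩
    refine hm.le.trans ?_
    rw [mul_comm]
    gcongr
    simp
  refine ⟨_, hK K hKc m, ?_⟩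
  rintro _ ⟨π, hπ, rfl⟩
  have hL : MeasurableSet (closure {y : E | (⨅ x ∈ K, c (x, y)) ≤ (m : ℝ≥0∞)})ᶜ :=
    isClosed_closure.measurableSet.compl
  rw [Measure.snd_apply hL]
  calc π (Prod.snd ⁻¹' (closure {y : E | (⨅ x ∈ K, c (x, y)) ≤ (m : ℝ≥0∞)})ᶜ)
      ≤ π (Prod.fst ⁻¹' Kᶜ ∪ {z | (m : ℝ≥0∞) ≤ c z}) := by
        refine measure_mono fun z hz => ?_
        by_cases hzK : z.1 ∈ K
        · right
          have h1 : z.2 ∉ {y : E | (⨅ x ∈ K, c (x, y)) ≤ (m : ℝ≥0∞)} := fun h =>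
            hz (subset_closure h)
          have h2 : (⨅ x ∈ K, c (x, z.2)) ≤ c (z.1, z.2) := iInf₂_le z.1 hzK
          exact (not_le.1 h1).le.trans h2
        · exact Or.inl hzK
    _ ≤ π (Prod.fst ⁻¹' Kᶜ) + π {z | (m : ℝ≥0∞) ≤ c z} := measure_union_le _ _
    _ ≤ ε / 2 + ε / 2 := by
        refine add_le_add ?_ ?_
        · rw [← Measure.fst_apply hKc.isClosed.measurableSet.compl]
          exact hKS _ ⟨π, hπ, rfl⟩
        · refine (meas_ge_le_lintegral_div hc.aemeasurable (by simpa using hm0.ne')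
            ENNReal.coe_ne_top).trans (le_trans ?_ hm)
          gcongr
          exact hSb π hπ
    _ = ε := ENNReal.add_halves ε

/-- A weakly convergent sequence of probability measures on a Polish space is tight. -/
lemma isTightMeasureSet_range_of_tendsto {νs : ℕ → ProbabilityMeasure E} {ν : ProbabilityMeasure E}
    (h : Tendsto νs atTop (𝓝 ν)) :
    IsTightMeasureSet (Set.range fun n => (νs n : Measure E)) := by
  let _ := TopologicalSpace.upgradeIsCompletelyMetrizable E
  have h1 : IsCompact (closure (insert ν (Set.range νs))) :=
    h.isCompact_insert_range.isClosed.closure_eq.symm ▸ h.isCompact_insert_range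
  refine (isTightMeasureSet_of_isCompact_closure h1).subset ?_
  rintro _ ⟨n, rfl⟩
  exact ⟨νs n, Or.inr ⟨n, rfl⟩, rfl⟩

/-- If the empirical measures of `x` converge to `μ`, then the gap of `x` and any `y` is
asymptotically bounded below by the static gap. -/
lemma staticGap_le_liminf_pathwiseGap {c : E × E → ℝ≥0∞} (hc : LowerSemicontinuous c)
    (hK : ∀ K : Set E, IsCompact K → ∀ m : ℝ≥0,
      IsCompact (closure {y : E | (⨅ x ∈ K, c (x, y)) ≤ (m : ℝ≥0∞)}))
    (F : ProbabilityMeasure E →ᵇ ℝ) {μ : ProbabilityMeasure E} {x y : ∀ n : ℕ, Fin (n + 1) → E}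
    (hx : Tendsto (fun n => empiricalMeasure (x n)) atTop (𝓝 μ)) :
    staticGap c F μ ≤ liminf (fun n => pathwiseGap c F (x n) (y n)) atTop := by
  by_contra! hlt
  obtain ⟨b, hb1, hb2⟩ := exists_between hlt
  have hfreq : ∃ᶠ n in atTop, pathwiseGap c F (x n) (y n) < b := frequently_lt_of_liminf_lt
    (by isBoundedDefault) hb1
  obtain ⟨φ, hφ, hφb⟩ := extraction_of_frequently_atTop hfreq
  let π : ℕ → ProbabilityMeasure (E × E) := fun n => empiricalMeasure fun i => (x n i, y n i)
  have hπ1 : ∀ n, (π n).map measurable_fst.aemeasurable = empiricalMeasure (x n) := fun n =>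
    map_empiricalMeasure _ measurable_fst
  have hπ2 : ∀ n, (π n).map measurable_snd.aemeasurable = empiricalMeasure (y n) := fun n =>
    map_empiricalMeasure _ measurable_snd
  have hgap : ∀ n, penalty F ((π n).map measurable_snd.aemeasurable)
      + ∫⁻ z, c z ∂(π n : Measure (E × E)) = pathwiseGap c F (x n) (y n) := fun n => by
    rw [hπ2, lintegral_empiricalMeasure _ hc.measurable, pathwiseGap]
  have htight : IsTightMeasureSet {((ρ : ProbabilityMeasure (E × E)) : Measure (E × E)) |
      ρ ∈ Set.range fun k => π (φ k)} := by
    refine isTightMeasureSet_of_lintegral_le hc.measurable hK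
      ((isTightMeasureSet_range_of_tendsto hx).subset ?_) hb2.ne_top (b := b) ?_
    · rintro _ ⟨_, ⟨_, ⟨k, rfl⟩, rfl⟩, rfl⟩
      exact ⟨φ k, congrArg ProbabilityMeasure.toMeasure (hπ1 (φ k)).symm⟩
    · rintro _ ⟨_, ⟨k, rfl⟩, rfl⟩
      exact (le_add_self.trans (hgap (φ k)).le).trans (hφb k).le
  obtain ⟨ρ, -, ψ, hψ, hρ⟩ := (isCompact_closure_of_isTightMeasureSet htight).tendsto_subseq
    fun k => subset_closure (Set.mem_range_self k)
  have hρ1 : ρ.map measurable_fst.aemeasurable = μ := by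
    have h1 := ((ProbabilityMeasure.continuous_map continuous_fst).tendsto ρ).comp hρ
    refine tendsto_nhds_unique h1 ?_
    refine (hx.comp (hφ.comp hψ).tendsto_atTop).congr fun k => ?_
    exact (hπ1 _).symm
  have hρ2 : Tendsto (fun k => penalty F ((π (φ (ψ k))).map measurable_snd.aemeasurable)) atTop
      (𝓝 (penalty F (ρ.map measurable_snd.aemeasurable))) :=
    ((continuous_penalty F).tendsto _).comp
      (((ProbabilityMeasure.continuous_map continuous_snd).tendsto ρ).comp hρ)
  have hle : penalty F (ρ.map measurable_snd.aemeasurable) + ∫⁻ z, c z ∂(ρ : Measure (E × E))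
      ≤ b := by
    have hpen : penalty F (ρ.map measurable_snd.aemeasurable) ≤ b :=
      le_of_tendsto' hρ2 fun k => (le_self_add.trans (hgap _).le).trans (hφb (ψ k)).le
    -- The penalty converges and is finite, so it can be moved to the right before the liminf of the
    -- costs is taken.
    have hcost : ∫⁻ z, c z ∂(ρ : Measure (E × E))
        ≤ b - penalty F (ρ.map measurable_snd.aemeasurable) := by
      have hlim := ENNReal.Tendsto.sub (tendsto_const_nhds (x := b) (f := atTop)) hρ2
        (Or.inl hb2.ne_top)
      refine (lintegral_le_liminf_lintegral_of_tendsto hc hρ).trans ?_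
      rw [← hlim.liminf_eq]
      refine liminf_le_liminf (Eventually.of_forall fun k => ?_)
      refine ENNReal.le_sub_of_add_le_left
        (((penalty_le F _).trans_lt ENNReal.ofReal_lt_top).ne) ?_
      exact (hgap _).le.trans (hφb (ψ k)).le
    calc _ ≤ penalty F (ρ.map measurable_snd.aemeasurable)
          + (b - penalty F (ρ.map measurable_snd.aemeasurable)) := by gcongr
      _ = b := add_tsub_cancel_of_le hpen
  exact absurd ((iInf₂_le ρ hρ1).trans hle) (not_le.2 hb2)

lemma measurable_pathwiseGap {c : E × E → ℝ≥0∞} (hc : Measurable c)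
    (F : ProbabilityMeasure E →ᵇ ℝ) {n : ℕ} [NeZero n] {α : Type*} [MeasurableSpace α]
    {x y : α → Fin n → E} (hx : ∀ i, Measurable fun a => x a i)
    (hy : ∀ i, Measurable fun a => y a i) :
    Measurable fun a => pathwiseGap c F (x a) (y a) := by
  have h1 : Measurable fun a => penalty F (empiricalMeasure (y a)) :=
    ((continuous_penalty F).comp continuous_empiricalMeasure).measurable.comp
      (measurable_pi_lambda _ hy)
  have h2 : Measurable fun a => ∑ i, c (x a i, y a i) :=
    Finset.measurable_sum _ fun i _ => hc.comp ((hx i).prodMk (hy i))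
  exact h1.add (h2.const_mul _)

variable {Ω : Type*} [MeasurableSpace Ω]

/-- The expected gap of a control `Y`. -/
noncomputable def expectedGap (P : Measure Ω) (X : ℕ → Ω → E) (c : E × E → ℝ≥0∞)
    (F : ProbabilityMeasure E →ᵇ ℝ) {n : ℕ} [NeZero n] (Y : Fin n → Ω → E) : ℝ≥0∞ :=
  ∫⁻ ω, pathwiseGap c F (fun i => X i ω) (fun i => Y i ω) ∂P

/-- The pathwise bound holds almost surely, and Fatou integrates it. The bound covers all measurable
controls, even anticipating ones. -/
lemma staticGap_le_liminf_expectedGap (P : Measure Ω) [IsProbabilityMeasure P]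
    {μ : ProbabilityMeasure E} {X : ℕ → Ω → E} (hX : ∀ i, Measurable (X i))
    (hlaw : ∀ i, P.map (X i) = (μ : Measure E)) (hindep : iIndepFun X P)
    {c : E × E → ℝ≥0∞} (hc : LowerSemicontinuous c)
    (hK : ∀ K : Set E, IsCompact K → ∀ m : ℝ≥0,
      IsCompact (closure {y : E | (⨅ x ∈ K, c (x, y)) ≤ (m : ℝ≥0∞)}))
    (F : ProbabilityMeasure E →ᵇ ℝ) {Y : ∀ n : ℕ, Fin (n + 1) → Ω → E}
    (hY : ∀ n i, Measurable (Y n i)) :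
    staticGap c F μ ≤ liminf (fun n => expectedGap P X c F (Y n)) atTop := by
  calc staticGap c F μ = ∫⁻ _, staticGap c F μ ∂P := by simp
    _ ≤ ∫⁻ ω, liminf (fun n => pathwiseGap c F (n := n + 1) (fun i => X i ω)
        (fun i => Y n i ω)) atTop ∂P := by
      refine lintegral_mono_ae ?_
      filter_upwards [ae_tendsto_empiricalMeasure P μ X hX hlaw hindep] with ω hω
      exact staticGap_le_liminf_pathwiseGap hc hK F hω
    _ ≤ _ := lintegral_liminf_le fun n =>
      measurable_pathwiseGap hc.measurable F (fun i => hX i) (hY n)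

end UpperBound

/-! ### Adapted controls -/

section AdaptedControls

variable {E Ω : Type*} [MeasurableSpace E]

lemma measurable_of_mem_adaptedControls [MeasurableSpace Ω] {X : ℕ → Ω → E}
    (hX : ∀ i, Measurable (X i)) {n : ℕ}
    {Y : Fin n → Ω → E} (hY : Y ∈ adaptedControls X n) (i : Fin n) : Measurable (Y i) :=
  (hY i).mono (iSup₂_le fun j _ => (hX j).comap_le) le_rfl

lemma comp_mem_adaptedControls (X : ℕ → Ω → E) {n : ℕ} {g : Fin n → E → E}
    (hg : ∀ i, Measurable (g i)) : (fun i ω => g i (X i ω)) ∈ adaptedControls X n := by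
  intro k
  have h1 : Measurable[MeasurableSpace.comap (X k) inferInstance] (X k) :=
    comap_measurable (X k)
  exact (hg k).comp (h1.mono (le_iSup₂ (f := fun (j : ℕ) (_ : j ≤ (k : ℕ)) =>
    MeasurableSpace.comap (X j) inferInstance) (k : ℕ) le_rfl) le_rfl)

lemma map_fin_eq_pi_of_iIndepFun [MeasurableSpace Ω] {P : Measure Ω}
    [IsProbabilityMeasure P] {ν : Measure E} {X : ℕ → Ω → E} (hX : ∀ i, Measurable (X i))
    (hlaw : ∀ i, P.map (X i) = ν) (hindep : iIndepFun X P) (n : ℕ) :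
    P.map (fun ω (i : Fin n) => X i ω) = Measure.pi fun _ => ν := by
  have h := hindep.precomp (g := fun i : Fin n => (i : ℕ)) Fin.val_injective
  have h2 := (iIndepFun_iff_map_fun_eq_pi_map fun i : Fin n => (hX i).aemeasurable).1 h
  simpa only [hlaw] using h2

end AdaptedControls

/-! ### Near-optimal controls from couplings -/

section LowerBound

variable {E : Type*} [TopologicalSpace E] [PolishSpace E] [MeasurableSpace E] [BorelSpace E]

/-- A coupling with first marginal `μ` is the law of `(X, h(X, U))` for `X` of law `μ` and an
independent uniform `U`. -/
lemma exists_measurePreserving_prod_unitInterval (π : ProbabilityMeasure (E × E)) :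
    ∃ h : E × unitInterval → E, Measurable h ∧
      MeasurePreserving (fun p => (p.1, h p))
        ((π.map measurable_fst.aemeasurable : Measure E).prod volume) (π : Measure (E × E)) := by
  obtain ⟨z⟩ := (π : Measure (E × E)).nonempty_of_neZero
  have : Nonempty E := ⟨z.1⟩
  -- The conditional law of the second coordinate given the first is realised as an image of
  -- Lebesgue measure, measurably in the first.
  obtain ⟨h, hm, hh⟩ := Kernel.exists_measurable_map_eq_unitInterval
    (π : Measure (E × E)).condKernel
  have hm' : Measurable fun p : E × unitInterval => (p.1, Function.uncurry h p) :=
    measurable_fst.prodMk hm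
  refine ⟨Function.uncurry h, hm, hm', ?_⟩
  refine Measure.ext_of_lintegral _ fun g hg => ?_
  conv_rhs => rw [← (π : Measure (E × E)).disintegrate (π : Measure (E × E)).condKernel]
  rw [lintegral_map hg hm', lintegral_prod (fun p => g (p.1, Function.uncurry h p))
      (hg.comp hm').aemeasurable,
    Measure.lintegral_compProd hg]
  refine lintegral_congr fun x => ?_
  rw [← hh x, lintegral_map (f := fun y => g (x, y)) (hg.comp measurable_prodMk_left)
    hm.of_uncurry_left]
  rfl

variable {Ω : Type*} [MeasurableSpace Ω]

/-- Randomised controls are no better than adapted ones: freeze the additional randomness. -/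
lemma exists_mem_adaptedControls_expectedGap_le {P : Measure Ω} [IsProbabilityMeasure P]
    {X : ℕ → Ω → E} (hX : ∀ i, Measurable (X i)) (hindep : iIndepFun X P)
    {c : E × E → ℝ≥0∞} (hc : Measurable c) (F : ProbabilityMeasure E →ᵇ ℝ)
    (π : ProbabilityMeasure (E × E))
    (hlaw : ∀ i, P.map (X i) = (π.map measurable_fst.aemeasurable : Measure E))
    (n : ℕ) [NeZero n] :
    ∃ Y ∈ adaptedControls X n, expectedGap P X c F Y ≤
      ∫⁻ z, pathwiseGap c F (fun i => (z i).1) (fun i => (z i).2)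
        ∂Measure.pi fun _ : Fin n => (π : Measure (E × E)) := by
  obtain ⟨h, hm, hh⟩ := exists_measurePreserving_prod_unitInterval π
  let μ : Measure E := (π.map measurable_fst.aemeasurable : ProbabilityMeasure E)
  let G : (Fin n → E) × (Fin n → unitInterval) → ℝ≥0∞ := fun p =>
    pathwiseGap c F p.1 (fun i => h (p.1 i, p.2 i))
  have hG : Measurable G := measurable_pathwiseGap hc F (fun i => by fun_prop) (fun i => by fun_prop)
  have hXm : Measurable fun ω (i : Fin n) => X i ω := measurable_pi_lambda _ fun i => hX i
  let M : Measure (Fin n → E) := Measure.pi fun _ => μ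
  have hXP : MeasurePreserving (fun ω (i : Fin n) => X i ω) P M :=
    ⟨hXm, map_fin_eq_pi_of_iIndepFun hX hlaw hindep n⟩
  let V : Measure (Fin n → unitInterval) := Measure.pi fun _ => volume
  -- Some value `u` of the randomisation does no worse than the average.
  obtain ⟨u, hu⟩ := exists_le_lintegral (μ := V)
    (f := fun u => ∫⁻ x, G (x, u) ∂M)
    (Measurable.lintegral_prod_left' hG).aemeasurable
  refine ⟨fun i ω => h (X i ω, u i), comp_mem_adaptedControls X (g := fun i x => h (x, u i))
    fun i => hm.comp measurable_prodMk_right, ?_⟩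
  have hpi := measurePreserving_pi (fun _ : Fin n => μ.prod volume)
    (fun _ : Fin n => (π : Measure (E × E))) (f := fun _ p => (p.1, h p)) fun _ => hh
  have harrow := measurePreserving_arrowProdEquivProdArrow E unitInterval (Fin n)
    (fun _ => μ) (fun _ => volume)
  calc expectedGap P X c F (fun i ω => h (X i ω, u i))
      = ∫⁻ x, G (x, u) ∂M := by
        exact hXP.lintegral_comp (f := fun x => G (x, u)) (hG.comp measurable_prodMk_right)
    _ ≤ ∫⁻ u, ∫⁻ x, G (x, u) ∂M ∂V := hu
    _ = ∫⁻ p, G p ∂(M.prod V) :=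
        (lintegral_prod_symm' G hG).symm
    _ = _ := by
        rw [← harrow.lintegral_comp hG, ← hpi.lintegral_comp]
        · rfl
        · exact measurable_pathwiseGap hc F (fun i => by fun_prop) (fun i => by fun_prop)

/-- The expected cost is exactly `∫ c dπ` for every `n`, even when infinite. Only the bounded
penalty needs a limit, by dominated convergence. -/
lemma tendsto_lintegral_pathwiseGap {c : E × E → ℝ≥0∞} (hc : Measurable c)
    (F : ProbabilityMeasure E →ᵇ ℝ) (π : ProbabilityMeasure (E × E)) :
    Tendsto (fun n : ℕ => ∫⁻ z, pathwiseGap c F (fun i => (z i).1) (fun i => (z i).2)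
        ∂Measure.pi fun _ : Fin (n + 1) => (π : Measure (E × E))) atTop
      (𝓝 (penalty F (π.map measurable_snd.aemeasurable)
        + ∫⁻ z, c z ∂(π : Measure (E × E)))) := by
  -- A single infinite product carries all sample sizes at once, so that almost sure convergence
  -- makes sense.
  let Q : Measure (ℕ → E × E) := Measure.infinitePi fun _ => (π : Measure (E × E))
  have hlaw : ∀ i, Q.map (fun w : ℕ → E × E => w i) = (π : Measure (E × E)) := fun i =>
    (measurePreserving_eval_infinitePi (fun _ : ℕ => (π : Measure (E × E))) i).map_eq
  have hindep : iIndepFun (fun (i : ℕ) (w : ℕ → E × E) => w i) Q :=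
    iIndepFun_infinitePi (P := fun _ : ℕ => (π : Measure (E × E))) (X := fun _ ω => ω)
      fun _ => measurable_id
  have hpen : ∀ n, Measurable fun w : ℕ → E × E =>
      penalty F (empiricalMeasure fun i : Fin (n + 1) => (w i).2) := fun n =>
    ((continuous_penalty F).comp continuous_empiricalMeasure).measurable.comp (by fun_prop)
  have hkey : ∀ n : ℕ, ∫⁻ z, pathwiseGap c F (fun i => (z i).1) (fun i => (z i).2)
        ∂(Measure.pi fun _ : Fin (n + 1) => (π : Measure (E × E)))
      = ∫⁻ w, penalty F (empiricalMeasure fun i : Fin (n + 1) => (w i).2) ∂Q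
        + ∫⁻ z, c z ∂(π : Measure (E × E)) := by
    intro n
    have hmp : MeasurePreserving (fun (w : ℕ → E × E) (i : Fin (n + 1)) => w i) Q
        (Measure.pi fun _ => (π : Measure (E × E))) :=
      ⟨by fun_prop, map_fin_eq_pi_of_iIndepFun (fun i => measurable_pi_apply i) hlaw hindep _⟩
    have hci : ∀ i : Fin (n + 1), ∫⁻ w : ℕ → E × E, c ((w i).1, (w i).2) ∂Q
        = ∫⁻ z, c z ∂(π : Measure (E × E)) := fun i => by
      rw [← hlaw i, lintegral_map hc (measurable_pi_apply _)]
    rw [← hmp.lintegral_comp (measurable_pathwiseGap hc F (fun i => by fun_prop)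
      (fun i => by fun_prop))]
    simp only [pathwiseGap]
    rw [lintegral_add_left (hpen n), lintegral_const_mul', lintegral_finsetSum]
    · simp_rw [hci]
      rw [Finset.sum_const, Finset.card_univ, Fintype.card_fin, nsmul_eq_mul, ← mul_assoc,
        ENNReal.inv_mul_cancel (by simp) (ENNReal.natCast_ne_top _), one_mul]
    · exact fun i _ => hc.comp (by fun_prop)
    · simp
  simp_rw [hkey]
  refine Tendsto.add ?_ tendsto_const_nhds
  have hlim := tendsto_lintegral_of_dominated_convergence (μ := Q)
    (F := fun (n : ℕ) w => penalty F (empiricalMeasure fun i : Fin (n + 1) => (w i).2))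
    (f := fun _ => penalty F (π.map measurable_snd.aemeasurable))
    (fun _ => ENNReal.ofReal (‖F‖ + ‖F‖)) hpen
    (fun n => Eventually.of_forall fun w => penalty_le F _) (by simp) ?_
  · simpa using hlim
  · filter_upwards [ae_tendsto_empiricalMeasure Q (π.map measurable_snd.aemeasurable)
      (fun i w => (w i).2) (fun i => by fun_prop)
      (fun i => by
        rw [ProbabilityMeasure.toMeasure_map, ← hlaw i,
          Measure.map_map measurable_snd (measurable_pi_apply i)]
        rfl)
      (hindep.comp (fun _ => Prod.snd) fun _ => measurable_snd)] with w hw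
    exact ((continuous_penalty F).tendsto _).comp hw

end LowerBound

/-! ### From gaps back to payoffs -/

section Conversion

/-- The order-reversing embedding `t ↦ a - t` of `[0, ∞]` into `[-∞, ∞)`. -/
noncomputable def subENNReal (a : ℝ) (t : ℝ≥0∞) : EReal := (a : EReal) - (t : EReal)

lemma antitone_subENNReal (a : ℝ) : Antitone (subENNReal a) := fun _ _ hst =>
  EReal.sub_le_sub le_rfl (EReal.coe_ennreal_le_coe_ennreal_iff.2 hst)

lemma continuous_subENNReal (a : ℝ) : Continuous (subENNReal a) := by
  refine continuous_iff_continuousAt.2 fun t => ?_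
  have h1 : ContinuousAt (fun p : EReal × EReal => p.1 + p.2) ((a : EReal), -(t : EReal)) :=
    EReal.continuousAt_add (Or.inl (EReal.coe_ne_top a)) (Or.inl (EReal.coe_ne_bot a))
  have h2 : Continuous fun t : ℝ≥0∞ => ((a : EReal), -(t : EReal)) :=
    continuous_const.prodMk (continuous_neg.comp continuous_coe_ennreal_ereal)
  exact ContinuousAt.comp (f := fun t : ℝ≥0∞ => ((a : EReal), -(t : EReal))) h1 h2.continuousAt

lemma subENNReal_iInf {ι : Sort*} (a : ℝ) (f : ι → ℝ≥0∞) :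
    subENNReal a (⨅ i, f i) = ⨆ i, subENNReal a (f i) :=
  (antitone_subENNReal a).map_iInf_of_continuousAt (continuous_subENNReal a).continuousAt
    -- The empty infimum `∞` goes to the empty supremum `-∞`.
    (by simp [subENNReal])

lemma subENNReal_ofReal_add {a b : ℝ} (hb : b ≤ a) (t : ℝ≥0∞) :
    subENNReal a (ENNReal.ofReal (a - b) + t) = (b : EReal) - (t : EReal) := by
  induction t with
  | top => simp [subENNReal]
  | coe t =>
    rw [subENNReal, EReal.coe_ennreal_add, EReal.coe_ennreal_ofReal,
      max_eq_left (sub_nonneg.2 hb)]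
    change (a : EReal) - (((a - b : ℝ) : EReal) + ((t : ℝ) : EReal)) = b - ((t : ℝ) : EReal)
    norm_cast
    ring

end Conversion

/-! ### The static problem over couplings -/

section StaticProblem

lemma mem_couplingsFrom {E : Type*} [MeasurableSpace E] {μ : ProbabilityMeasure E} {π : ProbabilityMeasure (E × E)} :
    π ∈ couplingsFrom μ ↔ π.map measurable_fst.aemeasurable = μ := by
  simp [couplingsFrom, couplings]

lemma iInf_penalty_add_transportCost {E : Type*} [TopologicalSpace E] [MeasurableSpace E]
    [OpensMeasurableSpace E] (c : E × E → ℝ≥0∞) (F : ProbabilityMeasure E →ᵇ ℝ)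
    (μ : ProbabilityMeasure E) :
    ⨅ ν, (penalty F ν + transportCost c μ ν) = staticGap c F μ := by
  refine le_antisymm (le_iInf₂ fun π hπ => ?_) (le_iInf fun ν => ?_)
  · refine iInf_le_of_le (π.map measurable_snd.aemeasurable) ?_
    gcongr
    exact iInf₂_le π ⟨hπ, rfl⟩
  · simp_rw [transportCost, ENNReal.add_iInf]
    refine le_iInf₂ fun π hπ => (iInf₂_le π hπ.1).trans_eq ?_
    rw [hπ.2]

end StaticProblem

/-! ### Convergence of the control values -/

section Value

variable {E Ω : Type*} [TopologicalSpace E] [PolishSpace E] [MeasurableSpace E] [BorelSpace E]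
  [MeasurableSpace Ω]

lemma objective_eq_subENNReal (P : Measure Ω) [IsProbabilityMeasure P] (X : ℕ → Ω → E)
    (c : E × E → ℝ≥0∞) (F : ProbabilityMeasure E →ᵇ ℝ) {n : ℕ} [NeZero n] {Y : Fin n → Ω → E}
    (hY : ∀ i, Measurable (Y i)) :
    objective P X c F Y = subENNReal ‖F‖ (expectedGap P X c F Y) := by
  have hL : Measurable fun ω => F (empiricalMeasure fun i => Y i ω) :=
    (F.continuous.comp continuous_empiricalMeasure).measurable.comp (measurable_pi_lambda _ hY)
  have hint : Integrable (fun ω => F (empiricalMeasure fun i => Y i ω)) P :=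
    Integrable.of_bound hL.aestronglyMeasurable ‖F‖
      (Eventually.of_forall fun ω => F.norm_coe_le_norm _)
  have hle : ∀ ω, F (empiricalMeasure fun i => Y i ω) ≤ ‖F‖ := fun ω =>
    (le_abs_self _).trans (F.norm_coe_le_norm _)
  have hpen : ∫⁻ ω, penalty F (empiricalMeasure fun i => Y i ω) ∂P
      = ENNReal.ofReal (‖F‖ - ∫ ω, F (empiricalMeasure fun i => Y i ω) ∂P) := by
    have h := ofReal_integral_eq_lintegral_ofReal (μ := P)
      (f := fun ω => ‖F‖ - F (empiricalMeasure fun i => Y i ω))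
      ((integrable_const _).sub hint) (Eventually.of_forall fun ω => sub_nonneg.2 (hle ω))
    rw [integral_sub (integrable_const _) hint] at h
    simpa [penalty] using h.symm
  have hmeas : Measurable fun ω => penalty F (empiricalMeasure fun i => Y i ω) :=
    ENNReal.measurable_ofReal.comp (measurable_const.sub hL)
  have hF : ∫ ω, F (empiricalMeasure fun i => Y i ω) ∂P ≤ ‖F‖ := by
    simpa using integral_mono hint (integrable_const ‖F‖) hle
  rw [objective, ← subENNReal_ofReal_add hF, ← hpen, ← lintegral_add_left hmeas]
  rfl

lemma controlValue_eq_subENNReal (P : Measure Ω) [IsProbabilityMeasure P] {X : ℕ → Ω → E}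
    (hX : ∀ i, Measurable (X i)) (c : E × E → ℝ≥0∞)
    (F : ProbabilityMeasure E →ᵇ ℝ) (n : ℕ) [NeZero n] :
    controlValue P X c F n
      = subENNReal ‖F‖ (⨅ Y ∈ adaptedControls X n, expectedGap P X c F Y) := by
  simp_rw [subENNReal_iInf, controlValue]
  exact iSup_congr fun Y => iSup_congr fun hY => objective_eq_subENNReal P X c F
    (measurable_of_mem_adaptedControls hX hY)

lemma tendsto_iInf_expectedGap (P : Measure Ω) [IsProbabilityMeasure P]
    {μ : ProbabilityMeasure E} {X : ℕ → Ω → E} (hX : ∀ i, Measurable (X i))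
    (hlaw : ∀ i, P.map (X i) = (μ : Measure E)) (hindep : iIndepFun X P)
    {c : E × E → ℝ≥0∞} (hc : LowerSemicontinuous c)
    (hK : ∀ K : Set E, IsCompact K → ∀ m : ℝ≥0,
      IsCompact (closure {y : E | (⨅ x ∈ K, c (x, y)) ≤ (m : ℝ≥0∞)}))
    (F : ProbabilityMeasure E →ᵇ ℝ) :
    Tendsto (fun n : ℕ => ⨅ Y ∈ adaptedControls X (n + 1), expectedGap P X c F Y) atTop
      (𝓝 (staticGap c F μ)) := by
  refine tendsto_of_le_liminf_of_limsup_le ?_ (le_iInf₂ fun π hπ => ?_)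
  · refine le_of_forall_lt_imp_le_of_dense fun b hb => ?_
    -- The infimum need not be attained: a control below `b` is chosen whenever the infimum is below
    -- `b`, and `Y = X` otherwise.
    have hex : ∀ n : ℕ, ∃ Y ∈ adaptedControls X (n + 1),
        (⨅ Y ∈ adaptedControls X (n + 1), expectedGap P X c F Y) < b →
          expectedGap P X c F Y < b := by
      intro n
      by_cases h : (⨅ Y ∈ adaptedControls X (n + 1), expectedGap P X c F Y) < b
      · obtain ⟨Y, hY, hYb⟩ := by simpa only [iInf_lt_iff, exists_prop] using h
        exact ⟨Y, hY, fun _ => hYb⟩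
      · exact ⟨_, comp_mem_adaptedControls X (g := fun _ x => x) fun _ => measurable_id,
          fun h' => absurd h' h⟩
    choose Y hY hYb using hex
    have hlt := hb.trans_le (staticGap_le_liminf_expectedGap P hX hlaw hindep hc hK F fun n =>
      measurable_of_mem_adaptedControls hX (hY n))
    refine le_liminf_of_le (by isBoundedDefault) ?_
    filter_upwards [eventually_lt_of_lt_liminf hlt (by isBoundedDefault)] with n hn
    exact not_lt.1 fun h => (hYb n h).not_gt hn
  · have hlim := tendsto_lintegral_pathwiseGap hc.measurable F π
    rw [← hlim.limsup_eq]
    refine limsup_le_limsup (Eventually.of_forall fun n => ?_)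
    obtain ⟨Y, hY, hle⟩ := exists_mem_adaptedControls_expectedGap_le hX hindep hc.measurable F π
      (by rwa [hπ]) (n + 1)
    exact (iInf₂_le Y hY).trans hle

end Value

end TransportControl

theorem corollary1p5
    {E : Type*} [TopologicalSpace E] [PolishSpace E] [MeasurableSpace E] [BorelSpace E]
    {Ω : Type*} [MeasurableSpace Ω] (P : Measure Ω) [IsProbabilityMeasure P]
    (μ : ProbabilityMeasure E)
    (X : ℕ → Ω → E) (hX : ∀ i, Measurable (X i))
    (hlaw : ∀ i, P.map (X i) = (μ : Measure E)) (hindep : iIndepFun X P)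
    (c : E × E → ℝ≥0∞) (hc : LowerSemicontinuous c)
    (hK : ∀ K : Set E, IsCompact K → ∀ m : ℝ≥0,
      IsCompact (closure {y : E | (⨅ x ∈ K, c (x, y)) ≤ (m : ℝ≥0∞)}))
    (F : ProbabilityMeasure E →ᵇ ℝ) :
    Tendsto (fun n : ℕ => TransportControl.controlValue P X c F (n + 1)) atTop
        (𝓝 (⨆ ν : ProbabilityMeasure E,
          ((F ν : ℝ) : EReal) - ((TransportControl.transportCost c μ ν : ℝ≥0∞) : EReal))) ∧
      (⨆ ν : ProbabilityMeasure E,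
          ((F ν : ℝ) : EReal) - ((TransportControl.transportCost c μ ν : ℝ≥0∞) : EReal)) =
        ⨆ π ∈ TransportControl.couplingsFrom μ,
          ((F (π.map measurable_snd.aemeasurable) : ℝ) : EReal)
            - ((∫⁻ z, c z ∂(π : Measure (E × E)) : ℝ≥0∞) : EReal) := by
  have hF : ∀ (ν : ProbabilityMeasure E) (t : ℝ≥0∞), ((F ν : ℝ) : EReal) - (t : EReal)
      = TransportControl.subENNReal ‖F‖ (TransportControl.penalty F ν + t) := fun ν t =>
    (TransportControl.subENNReal_ofReal_add ((le_abs_self _).trans (F.norm_coe_le_norm ν)) t).symm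
  have hν : (⨆ ν : ProbabilityMeasure E,
      ((F ν : ℝ) : EReal) - ((TransportControl.transportCost c μ ν : ℝ≥0∞) : EReal))
      = TransportControl.subENNReal ‖F‖ (TransportControl.staticGap c F μ) := by
    rw [← TransportControl.iInf_penalty_add_transportCost, TransportControl.subENNReal_iInf]
    exact iSup_congr fun ν => hF ν _
  rw [hν]
  refine ⟨?_, ?_⟩
  · simp_rw [TransportControl.controlValue_eq_subENNReal P hX c F]
    exact ((TransportControl.continuous_subENNReal ‖F‖).tendsto _).comp
      (TransportControl.tendsto_iInf_expectedGap P hX hlaw hindep hc hK F)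
  · simp_rw [TransportControl.staticGap, TransportControl.subENNReal_iInf,
      TransportControl.mem_couplingsFrom, hF]
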